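/- Let $\kappa$ be a regular uncountable cardinal with $\kappa^{<\kappa}=\kappa$. A family $\mathcal F$ of subsets of $\kappa$ has the strong intersection property if $|\bigcap\mathcal F'|=\kappa$ for every subfamily $\mathcal F'\subseteq\mathcal F$ of size ${<}\kappa$ (where $\bigcap\emptyset=\kappa$). The pseudointersection number $\mathfrak p(\kappa)$ is the least size of a family $\mathcal F$ with the strong intersection property for which there is no $A\subseteq\kappa$ with $|A|=\kappa$ and $|A\setminus F|<\kappa$ for all $F\in\mathcal F$. Let $S(\kappa)$ be the group of all permutations of $\kappa$. A subgroup $G\le S(\kappa)$ is $\kappa$-cofinitary if every non-identity element of $G$ has fewer than $\kappa$ fixed points, and it is $\kappa$-maximal cofinitary if moreover no subgroup of $S(\kappa)$ properly containing $G$ is $\kappa$-cofinitary. Let $\mathfrak a_g(\kappa)$ be the least size of a $\kappa$-maximal cofinitary group. Then $$\mathfrak p(\kappa)\le\mathfrak a_g(\kappa).$$ -/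

import Mathlib

open Cardinal Set

universe u

namespace HigherBaire

/-- The underlying set of the cardinal `κ`: the ordinals below the initial ordinal of `κ`. -/
abbrev Pt (κ : Cardinal.{u}) : Type u := κ.ord.ToType

variable {κ : Cardinal.{u}}

/-- The strong intersection property: every subfamily of size `< κ` has an intersection of
size `κ`. The intersection of the empty subfamily is the whole set `κ`. -/
def HasSIP (F : Set (Set (Pt κ))) : Prop :=
  ∀ F' ⊆ F, #F' < κ → #(⋂₀ F' : Set (Pt κ)) = κ

/-- `B` is almost contained in `C` if `B \ C` has size `< κ`. -/
def AlmostSubset (B C : Set (Pt κ)) : Prop :=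
  #(B \ C : Set (Pt κ)) < κ

/-- `A` is a pseudointersection of `F`: it has size `κ` and is almost contained in every
member of `F`. -/
def IsPseudointersection (A : Set (Pt κ)) (F : Set (Set (Pt κ))) : Prop :=
  #A = κ ∧ ∀ B ∈ F, AlmostSubset A B

/-- The families with the strong intersection property and without a pseudointersection. -/
def IsWitness (F : Set (Set (Pt κ))) : Prop :=
  HasSIP F ∧ ¬ ∃ A, IsPseudointersection A F

/-- The pseudointersection number `𝔭(κ)`: the least size of a family with the strong
intersection property and without a pseudointersection. For regular uncountable `κ` such families
exist, see `exists_isWitness`. -/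
noncomputable def pNumber (κ : Cardinal.{u}) : Cardinal.{u} :=
  sInf {c | ∃ F : Set (Set (Pt κ)), IsWitness F ∧ #F = c}

/-- A permutation is `κ`-cofinitary if it has fewer than `κ` fixed points. -/
def IsCofinitaryPerm (f : Equiv.Perm (Pt κ)) : Prop :=
  #{x | f x = x} < κ

/-- A group of permutations is `κ`-cofinitary if all its non-identity elements are. -/
def IsCofinitaryGroup (G : Subgroup (Equiv.Perm (Pt κ))) : Prop :=
  ∀ g ∈ G, g ≠ 1 → IsCofinitaryPerm g

/-- A `κ`-maximal cofinitary group: no proper supergroup in `S(κ)` is `κ`-cofinitary. -/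
def IsMaximalCofinitaryGroup (G : Subgroup (Equiv.Perm (Pt κ))) : Prop :=
  IsCofinitaryGroup G ∧ ∀ H, IsCofinitaryGroup H → G ≤ H → H = G

/-- `𝔞_g(κ)`: the least size of a `κ`-maximal cofinitary group. Such groups exist, see
`exists_isMaximalCofinitaryGroup`. -/
noncomputable def agNumber (κ : Cardinal.{u}) : Cardinal.{u} :=
  sInf {c | ∃ G : Subgroup (Equiv.Perm (Pt κ)), IsMaximalCofinitaryGroup G ∧ #G = c}

/-- The infimum in the definition of `𝔞_g(κ)` is over a non-empty set. -/
theorem exists_isMaximalCofinitaryGroup (κ : Cardinal.{u}) :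
    ∃ G : Subgroup (Equiv.Perm (Pt κ)), IsMaximalCofinitaryGroup G := by
  obtain ⟨G, -, hG⟩ := zorn_le_nonempty₀
    {G : Subgroup (Equiv.Perm (Pt κ)) | IsCofinitaryGroup G} (fun c hc hchain y hy => by
      refine ⟨sSup c, fun g hg hg1 => ?_, fun z hz => le_sSup hz⟩
      rw [Subgroup.mem_sSup_of_directedOn ⟨y, hy⟩ hchain.directedOn] at hg
      obtain ⟨H, hH, hgH⟩ := hg
      exact hc hH g hgH hg1) ⊥ (fun g hg hg1 => (hg1 (Subgroup.mem_bot.1 hg)).elim)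
  exact ⟨G, hG.1, fun H hH h => le_antisymm (hG.2 hH h) h⟩

/-- In a regular cardinal the cofinal subsets are those of full size. -/
theorem isCofinal_iff_mk_eq (hκ : κ.IsRegular) (A : Set (Pt κ)) : IsCofinal A ↔ #A = κ := by
  have hcof : Order.cof (Pt κ) = κ := by rw [Ordinal.cof_toType, hκ.cof_ord]
  constructor
  · intro h
    refine le_antisymm ((mk_set_le A).trans_eq (mk_ord_toType κ)) ?_
    exact hcof.symm.trans_le (Order.cof_le h)
  · intro h
    by_contra hA
    obtain ⟨x, hx⟩ := not_isCofinal_iff.1 hA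
    have h1 : #A ≤ #(Iio x) := mk_le_mk_of_subset hx
    have h2 : #(Iio x) < κ := by simpa using mk_Iio_lt x
    exact (h1.trans_lt h2).ne h

/-- The limit points of an unbounded set form a closed unbounded set. -/
theorem isClub_limitPoints (hκ : κ.IsRegular) (hω : ℵ₀ < κ) {A : Set (Pt κ)}
    (hA : IsCofinal A) : IsClub {x : Pt κ | ∀ b < x, ∃ a ∈ A, b < a ∧ a < x} := by
  have hcof : Order.cof (Pt κ) = κ := by rw [Ordinal.cof_toType, hκ.cof_ord]
  have : NoMaxOrder (Pt κ) := noMaxOrder hκ.aleph0_le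
  refine ⟨fun t ht _ _ x hx b hb => ?_, fun b => ?_⟩
  · obtain ⟨y, hy, hby⟩ := (lt_isLUB_iff hx).1 hb
    obtain ⟨a, ha, h1, h2⟩ := ht hy b hby
    exact ⟨a, ha, h1, h2.trans_le (hx.1 hy)⟩
  · have hstep : ∀ x : Pt κ, ∃ a ∈ A, x < a := fun x => by
      obtain ⟨y, hy⟩ := exists_gt x
      obtain ⟨a, ha, hya⟩ := hA y
      exact ⟨a, ha, hy.trans_le hya⟩
    choose f hfA hf using hstep
    let g : ℕ → Pt κ := fun n => Nat.rec b (fun _ y => f y) n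
    have hg : ¬ IsCofinal (range g) := fun h => by
      have h1 := Order.cof_le h
      rw [hcof] at h1
      have h2 : #(range g) ≤ ℵ₀ := le_aleph0_iff_set_countable.2 (countable_range g)
      exact (h1.trans h2).not_gt hω
    obtain ⟨z, hz⟩ := not_isCofinal_iff.1 hg
    have hne : (upperBounds (range g)).Nonempty := ⟨z, fun y hy => (hz y hy).le⟩
    obtain ⟨s, hs, hmin⟩ := WellFounded.has_min (wellFounded_lt (α := Pt κ)) _ hne
    refine ⟨s, fun c hc => ?_, hs ⟨0, rfl⟩⟩
    have : ∃ n, c < g n := by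
      by_contra hcon
      push Not at hcon
      exact hmin c (by rintro _ ⟨n, rfl⟩; exact hcon n) hc
    obtain ⟨n, hn⟩ := this
    refine ⟨g (n + 1), hfA _, hn.trans (hf _), (hf (g (n + 1))).trans_le (hs ⟨n + 2, rfl⟩)⟩

/-- The infimum in the definition of `𝔭(κ)` is over a non-empty set: the closed unbounded
sets have the strong intersection property and no pseudointersection. -/
theorem exists_isWitness (hκ : κ.IsRegular) (hω : ℵ₀ < κ) :
    ∃ F : Set (Set (Pt κ)), IsWitness F := by
  have hcof : Order.cof (Pt κ) = κ := by rw [Ordinal.cof_toType, hκ.cof_ord]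
  have : NoMaxOrder (Pt κ) := noMaxOrder hκ.aleph0_le
  refine ⟨{C | IsClub C}, fun F' hF' hc => ?_, ?_⟩
  · rw [← isCofinal_iff_mk_eq hκ]
    exact (IsClub.sInter (by rw [hcof]; exact hω.ne') (by rwa [hcof]) hF').isCofinal
  · rintro ⟨A, hA, hAF⟩
    have hAc := (isCofinal_iff_mk_eq hκ A).2 hA
    refine (hAF _ (isClub_limitPoints hκ hω hAc)).ne ?_
    rw [← isCofinal_iff_mk_eq hκ]
    intro b
    obtain ⟨y, hy⟩ := exists_gt b
    obtain ⟨a, haA, hya⟩ := hAc y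
    obtain ⟨m, ⟨hmA, hbm⟩, hmin⟩ := WellFounded.has_min (wellFounded_lt (α := Pt κ))
      {a | a ∈ A ∧ b < a} ⟨a, haA, hy.trans_le hya⟩
    refine ⟨m, ⟨hmA, fun h => ?_⟩, hbm.le⟩
    obtain ⟨c, hcA, hbc, hcm⟩ := h b hbm
    exact hmin c ⟨hcA, hbc⟩ hcm

end HigherBaire

/-! Let `G` be a maximal cofinitary group. The closure points of each `g ∈ G` form a club, so these
at most `#G` clubs have the strong intersection property. It remains to see that they have no
pseudointersection. From a pseudointersection `A`, `exists_perm_max_mem` builds a fixed-point-free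
`f` whose edges `{x, f x}` have distinct larger endpoints, all in `A`. A fixed point of a cyclically
reduced word in `G` and `f` gives a closed walk. At its largest point `m`, a coefficient `g ≠ 1` for
which `m` is a closure point of `g` and `g⁻¹` and not a fixed point would lead above `m`; a trivial
coefficient would make the walk backtrack along the same edge. So `m` is one of fewer than `κ` bad
points (`exists_not_escapes`), which bounds the fixed points. Hence `G` and `f` generate a larger
cofinitary group, against maximality. -/

namespace HigherBaire

variable {κ : Cardinal.{u}}

/-! ### Bounded sets and clubs of closure points -/

/-- A set of fewer than `κ` points is strictly bounded. -/
theorem exists_strict_bound (hκ : κ.IsRegular) {S : Set (Pt κ)} (hS : #S < κ) :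
    ∃ b, ∀ x ∈ S, x < b :=
  not_isCofinal_iff.1 fun h => hS.ne ((isCofinal_iff_mk_eq hκ S).1 h)

/-- Initial segments have size `< κ`. -/
theorem mk_Iic_lt_card (hκ : κ.IsRegular) (x : Pt κ) : #(Iic x) < κ := by
  have : NoMaxOrder (Pt κ) := noMaxOrder hκ.aleph0_le
  obtain ⟨y, hy⟩ := exists_gt x
  have h : #(Iio y) < κ := by simpa using mk_Iio_lt y
  exact (mk_le_mk_of_subset fun z hz => lt_of_le_of_lt hz hy).trans_lt h

/-- The points closed under a function form a closed unbounded set. -/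
theorem isClub_closurePoints (hκ : κ.IsRegular) (hω : ℵ₀ < κ) (φ : Pt κ → Pt κ) :
    IsClub {m : Pt κ | ∀ v < m, φ v < m} := by
  have hcof : Order.cof (Pt κ) = κ := by rw [Ordinal.cof_toType, hκ.cof_ord]
  have : NoMaxOrder (Pt κ) := noMaxOrder hκ.aleph0_le
  refine ⟨fun t ht _ _ x hx v hv => ?_, fun b => ?_⟩
  · obtain ⟨y, hy, hvy⟩ := (lt_isLUB_iff hx).1 hv
    exact (ht hy v hvy).trans_le (hx.1 hy)
  · have hstep : ∀ x : Pt κ, ∃ y, ∀ v ≤ x, φ v < y := fun x => by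
      obtain ⟨y, hy⟩ := exists_strict_bound hκ (mk_image_le.trans_lt (mk_Iic_lt_card hκ x))
      exact ⟨y, fun v hv => hy _ ⟨v, hv, rfl⟩⟩
    choose next hnext using hstep
    -- The supremum `m` of the iterates of `next` works: `v < m` lies below some `s n`, so `φ v`
    -- lies below `s (n + 1)`.
    let s : ℕ → Pt κ := fun n => Nat.rec b (fun _ y => next y) n
    have hs : #(range s) < κ :=
      (le_aleph0_iff_set_countable.2 (countable_range s)).trans_lt hω
    obtain ⟨z, hz⟩ := exists_strict_bound hκ hs
    obtain ⟨m, hm, hmin⟩ := WellFounded.has_min (wellFounded_lt (α := Pt κ))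
      (upperBounds (range s)) ⟨z, fun y hy => (hz y hy).le⟩
    refine ⟨m, fun v hv => ?_, hm ⟨0, rfl⟩⟩
    have : ∃ n, v < s n := by
      by_contra hcon
      push Not at hcon
      exact hmin v (by rintro _ ⟨n, rfl⟩; exact hcon n) hv
    obtain ⟨n, hn⟩ := this
    exact (hnext (s n) v hn.le).trans_le (hm ⟨n + 1, rfl⟩)

/-- A family of closed unbounded sets has the strong intersection property. -/
theorem hasSIP_of_isClub (hκ : κ.IsRegular) (hω : ℵ₀ < κ) {F : Set (Set (Pt κ))}
    (hF : ∀ C ∈ F, IsClub C) : HasSIP F := fun F' hF' hc => by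
  have hcof : Order.cof (Pt κ) = κ := by rw [Ordinal.cof_toType, hκ.cof_ord]
  rw [← isCofinal_iff_mk_eq hκ]
  exact (IsClub.sInter (by rw [hcof]; exact hω.ne') (by rwa [hcof])
    fun C hC => hF C (hF' hC)).isCofinal

/-! ### A permutation with prescribed larger endpoints -/

/-- The successor map of `ℤ` transported to `ℕ`: even numbers move up, odd numbers move down. -/
def zigzag : Equiv.Perm ℕ where
  toFun n := if n = 1 then 0 else if n % 2 = 0 then n + 2 else n - 2
  invFun n := if n = 0 then 1 else if n % 2 = 0 then n - 2 else n + 2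
  left_inv n := by grind
  right_inv n := by grind

theorem zigzag_ne (n : ℕ) : zigzag n ≠ n := by
  simp only [zigzag, Equiv.coe_fn_mk]; grind

/-- Only position `0` of a line may lie outside `A`, so it must never be the larger end of an edge.
-/
theorem max_zigzag_pos (n : ℕ) : 0 < max n (zigzag n) := by
  simp only [zigzag, Equiv.coe_fn_mk]; grind

theorem max_zigzag_injective : Function.Injective fun n => max n (zigzag n) := by
  intro m n h
  simp only [zigzag, Equiv.coe_fn_mk] at h
  grind

/-- A set of size `κ` contains an injective image of `κ × ℕ`, increasing in the second coordinate
and lying above the first one. -/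
theorem exists_increasing_lines (hκ : κ.IsRegular) (hω : ℵ₀ < κ) {A : Set (Pt κ)}
    (hA : #A = κ) : ∃ a : Pt κ → ℕ → Pt κ, (∀ d n, a d n ∈ A) ∧ (∀ d n, d < a d n) ∧
      (∀ d, StrictMono (a d)) ∧ ∀ d d' n n', a d n = a d' n' → d = d' ∧ n = n' := by
  have hcof := (isCofinal_iff_mk_eq hκ A).2 hA
  have hbound : ∀ S : Set (Pt κ), #S < κ → ∃ m ∈ A, ∀ x ∈ S, x < m := fun S hS => by
    obtain ⟨b, hb⟩ := exists_strict_bound hκ hS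
    obtain ⟨m, hm, hbm⟩ := hcof b
    exact ⟨m, hm, fun x hx => (hb x hx).trans_le hbm⟩
  -- Recursion along the lexicographic order: fewer than `κ` values precede each `p`, so the next
  -- one can be taken in `A` above them all.
  have hpred : ∀ p : Pt κ ×ₗ ℕ, #(Iio p) < κ := fun p => by
    have hinj : Function.Injective
        (fun q : Iio p => ((⟨(ofLex q.1).1, Prod.Lex.monotone_fst_ofLex (mem_Iio.1 q.2).le⟩ : Iic (ofLex p).1),
          ULift.up.{u} (ofLex q.1).2)) := fun q r h => by
      simp only [Prod.mk.injEq, ULift.up.injEq] at h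
      exact Subtype.ext (ofLex.injective (Prod.ext (congrArg Subtype.val h.1) h.2))
    refine (mk_le_of_injective hinj).trans_lt ?_
    rw [mk_prod, Cardinal.lift_id, Cardinal.lift_id]
    exact mul_lt_of_lt hκ.aleph0_le (mk_Iic_lt_card hκ _) (by simpa using hω)
  have hstep : ∀ (p : Pt κ ×ₗ ℕ) (h : ∀ q, q < p → Pt κ),
      ∃ m ∈ A, (ofLex p).1 < m ∧ ∀ q (hq : q < p), h q hq < m := fun p h => by
    obtain ⟨m, hm, hS⟩ := hbound ({(ofLex p).1} ∪ range fun q : Iio p => h q.1 q.2) <|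
      (mk_union_le _ _).trans_lt <| add_lt_of_lt hκ.aleph0_le
        (by simpa using one_lt_aleph0.trans hω) (mk_range_le.trans_lt (hpred p))
    exact ⟨m, hm, hS _ (Or.inl rfl), fun q hq => hS _ (Or.inr ⟨⟨q, hq⟩, rfl⟩)⟩
  choose F hFA hF1 hF2 using hstep
  have wf : WellFounded ((· < ·) : Pt κ ×ₗ ℕ → Pt κ ×ₗ ℕ → Prop) := wellFounded_lt
  let c : Pt κ ×ₗ ℕ → Pt κ := wf.fix F
  have hc : ∀ p, c p = F p fun q _ => c q := fun p => wf.fix_eq F p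
  have hmono : StrictMono c := fun q p h => by
    rw [hc p]; exact hF2 p (fun q _ => c q) q h
  refine ⟨fun d n => c (toLex (d, n)), fun d n => ?_, fun d n => ?_, fun d m n h => ?_,
    fun d d' n n' h => ?_⟩
  · simp only [hc (toLex (d, n))]; exact hFA _ _
  · simp only [hc (toLex (d, n))]; exact hF1 (toLex (d, n)) _
  · exact hmono (Prod.Lex.toLex_lt_toLex.2 (Or.inr ⟨rfl, h⟩))
  · exact Prod.mk.inj (toLex.injective (hmono.injective h))

/-- For every set `A` of size `κ` there is a permutation without fixed points such that the larger
endpoints of the edges `{x, f x}` lie in `A` and determine the edge. -/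
theorem exists_perm_max_mem (hκ : κ.IsRegular) (hω : ℵ₀ < κ) {A : Set (Pt κ)} (hA : #A = κ) :
    ∃ f : Equiv.Perm (Pt κ), (∀ x, f x ≠ x) ∧ (∀ x, max x (f x) ∈ A) ∧
      Function.Injective fun x => max x (f x) := by
  classical
  obtain ⟨a, haA, hlt, hmono, hinj⟩ := exists_increasing_lines hκ hω hA
  -- The line of `d` is `a d`, preceded by `d` itself if `d` is not a value of `a`. The lines
  -- partition `κ`, and only their initial points can lie outside `A`.
  let B : Set (Pt κ) := {x | ∃ d n, a d n = x}
  let l : Pt κ → ℕ → Pt κ := fun d n => if d ∈ B then a d n else Nat.casesOn n d (a d)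
  have l_mem : ∀ {d}, d ∈ B → ∀ n, l d n = a d n := fun hd n => if_pos hd
  have l_zero : ∀ {d}, d ∉ B → l d 0 = d := fun hd => if_neg hd
  have l_succ : ∀ {d}, d ∉ B → ∀ n, l d (n + 1) = a d n := fun hd n => if_neg hd
  have hlmono : ∀ d, StrictMono (l d) := fun d => strictMono_nat_of_lt_succ fun n => by
    by_cases hd : d ∈ B
    · rw [l_mem hd, l_mem hd]; exact hmono d n.lt_succ_self
    · rw [l_succ hd]
      cases n with
      | zero => rw [l_zero hd]; exact hlt d 0
      | succ n => rw [l_succ hd]; exact hmono d n.lt_succ_self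
  have hlA : ∀ d n, 0 < n → l d n ∈ A := fun d n hn => by
    by_cases hd : d ∈ B
    · rw [l_mem hd]; exact haA _ _
    · obtain ⟨n, rfl⟩ := Nat.exists_eq_succ_of_ne_zero hn.ne'
      rw [l_succ hd]; exact haA _ _
  have hlbij : Function.Bijective fun p : Pt κ × ℕ => l p.1 p.2 := by
    constructor
    · rintro ⟨d, n⟩ ⟨d', n'⟩ h
      change l d n = l d' n' at h
      by_cases hd : d ∈ B <;> by_cases hd' : d' ∈ B
      · rw [l_mem hd, l_mem hd'] at h
        exact Prod.ext (hinj _ _ _ _ h).1 (hinj _ _ _ _ h).2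
      · rw [l_mem hd] at h
        cases n' with
        | zero => rw [l_zero hd'] at h; exact (hd' ⟨_, _, h⟩).elim
        | succ n' => rw [l_succ hd'] at h; exact (hd' ((hinj _ _ _ _ h).1 ▸ hd)).elim
      · rw [l_mem hd'] at h
        cases n with
        | zero => rw [l_zero hd] at h; exact (hd ⟨_, _, h.symm⟩).elim
        | succ n => rw [l_succ hd] at h; exact (hd ((hinj _ _ _ _ h).1 ▸ hd')).elim
      · cases n with
        | zero =>
          rw [l_zero hd] at h
          cases n' with
          | zero => rw [l_zero hd'] at h; rw [h]
          | succ n' => rw [l_succ hd'] at h; exact (hd ⟨_, _, h.symm⟩).elim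
        | succ n =>
          rw [l_succ hd] at h
          cases n' with
          | zero => rw [l_zero hd'] at h; exact (hd' ⟨_, _, h⟩).elim
          | succ n' =>
            rw [l_succ hd'] at h
            exact Prod.ext (hinj _ _ _ _ h).1 (congrArg (· + 1) (hinj _ _ _ _ h).2)
    · intro x
      by_cases hx : x ∈ B
      · obtain ⟨d, n, rfl⟩ := hx
        by_cases hd : d ∈ B
        · exact ⟨(d, n), l_mem hd n⟩
        · exact ⟨(d, n + 1), l_succ hd n⟩
      · exact ⟨(x, 0), l_zero hx⟩
  let e : Pt κ × ℕ ≃ Pt κ := Equiv.ofBijective _ hlbij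
  let f : Equiv.Perm (Pt κ) := e.symm.trans ((Equiv.prodCongr (Equiv.refl _) zigzag).trans e)
  have hf : ∀ d n, f (l d n) = l d (zigzag n) := fun d n => by
    have : e.symm (l d n) = (d, n) := e.symm_apply_eq.2 rfl
    simp only [f, Equiv.trans_apply, this]; rfl
  have hmax : ∀ d n, max (l d n) (f (l d n)) = l d (max n (zigzag n)) := fun d n => by
    rw [hf, (hlmono d).monotone.map_max]
  refine ⟨f, fun x => ?_, fun x => ?_, fun x y h => ?_⟩
  · obtain ⟨⟨d, n⟩, rfl⟩ := hlbij.2 x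
    simp only [hf]
    exact fun h => zigzag_ne n ((hlmono d).injective h)
  · obtain ⟨⟨d, n⟩, rfl⟩ := hlbij.2 x
    simp only [hmax]
    exact hlA _ _ (max_zigzag_pos n)
  · obtain ⟨⟨d, n⟩, rfl⟩ := hlbij.2 x
    obtain ⟨⟨d', n'⟩, rfl⟩ := hlbij.2 y
    simp only [hmax] at h
    have h' := hlbij.1 (a₁ := (d, _)) (a₂ := (d', _)) h
    obtain ⟨rfl, h2⟩ := Prod.mk.inj h'
    rw [max_zigzag_injective h2]

/-! ### Closed walks and their largest point -/

/-- The permutation `f ^ e * g` denoted by a letter `(g, e)`. -/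
def letterPerm {α : Type*} (f : Equiv.Perm α) (p : Equiv.Perm α × ℤˣ) : Equiv.Perm α :=
  f ^ (p.2 : ℤ) * p.1

/-- `m` is closed under `g` and its inverse, and is not fixed by `g` unless `g = 1`. -/
def Escapes (g : Equiv.Perm (Pt κ)) (m : Pt κ) : Prop :=
  (∀ v < m, g v < m) ∧ (∀ v < m, g⁻¹ v < m) ∧ (g m = m → g = 1)

/-- A nontrivial `g` that escapes at `m` joins `m` only to points above it, in either direction. -/
theorem Escapes.eq_of_apply_le {g : Equiv.Perm (Pt κ)} {m v : Pt κ} (h : Escapes g m)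
    (hv : v ≤ m) (hgv : g v = m) : g = 1 := by
  rcases hv.lt_or_eq with hlt | rfl
  · exact ((h.1 v hlt).ne hgv).elim
  · exact h.2.2 hgv

theorem Escapes.eq_of_le_apply {g : Equiv.Perm (Pt κ)} {m : Pt κ} (h : Escapes g m)
    (hv : g m ≤ m) : g = 1 := by
  rcases hv.lt_or_eq with hlt | heq
  · exact absurd (h.2.1 _ hlt) (by simp)
  · exact h.2.2 heq

/-- Along a closed walk, with edges of `f` alternating with applications of `g i`, that does not
backtrack, some `g i` does not escape at the largest point visited. -/
theorem exists_not_escapes {f : Equiv.Perm (Pt κ)} (hne : ∀ x, f x ≠ x)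
    (hinj : Function.Injective fun x => max x (f x)) {k : ℕ} (hk : 0 < k)
    {g : ℕ → Equiv.Perm (Pt κ)} {e : ℕ → ℤˣ} {x z : ℕ → Pt κ}
    (hred : ∀ i, g i = 1 → e (i + 1) = e i)
    (hx : ∀ i, x (i + k) = x i) (hz : ∀ i, z (i + k) = z i)
    (hf : ∀ i, (f ^ (e i : ℤ)) (z i) = x i) (hg : ∀ i, g i (x (i + 1)) = z i) :
    ∃ i j, x 0 ≤ max (x i) (z i) ∧ ¬ Escapes (g j) (max (x i) (z i)) := by
  obtain ⟨i₀, hi₀, hmax₀⟩ := (Finset.range k).exists_max_image (fun i => max (x i) (z i))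
    ⟨0, Finset.mem_range.2 hk⟩
  have hxm : ∀ n i, x (i + k * n) = x i := fun n => by
    induction n with
    | zero => simp
    | succ n ih => intro i; rw [Nat.mul_succ, ← Nat.add_assoc, hx, ih]
  have hzm : ∀ n i, z (i + k * n) = z i := fun n => by
    induction n with
    | zero => simp
    | succ n ih => intro i; rw [Nat.mul_succ, ← Nat.add_assoc, hz, ih]
  have hmax : ∀ j, max (x j) (z j) ≤ max (x i₀) (z i₀) := fun j => by
    have := hmax₀ (j % k) (Finset.mem_range.2 (Nat.mod_lt _ hk))
    rwa [← hxm (j / k) (j % k), ← hzm (j / k) (j % k), Nat.mod_add_div] at this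
  -- A shift by one period gives the maximal edge a predecessor.
  obtain ⟨i, hi⟩ : ∃ i, i + 1 = i₀ + k := ⟨i₀ + k - 1, by omega⟩
  rw [← hx i₀, ← hz i₀, ← hi] at hmax
  refine ⟨i + 1, ?_⟩
  by_contra! hcon
  have hesc := fun j => hcon j ((le_max_left _ _).trans (hmax 0))
  -- consecutive edges with equal maxima and a common endpoint agree up to direction
  have hedge : ∀ j, z j = x (j + 1) → max (x j) (z j) = max (x (j + 1)) (z (j + 1)) →
      e (j + 1) ≠ e j := by
    intro j hzx hm he
    have h1 := hf j
    have h2 := hf (j + 1)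
    rw [he] at h2
    rcases Int.units_eq_one_or (e j) with h | h <;> rw [h] at h1 h2
    · simp only [Units.val_one, zpow_one] at h1 h2
      rw [← h1, ← h2, max_comm, max_comm (f (z (j + 1)))] at hm
      have := hinj hm
      rw [this] at hzx
      exact hne _ (h2.trans hzx.symm)
    · simp only [Units.val_neg, Units.val_one, zpow_neg, zpow_one, Equiv.Perm.inv_eq_iff_eq] at h1 h2
      rw [h1, h2] at hm
      have := hinj hm
      rw [h1, this] at hzx
      exact hne _ hzx
  -- The coefficient applied at the maximal end joins it to a point not above it, so it is trivial,
  -- and the adjacent edge has the same maximum.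
  rcases le_total (x (i + 1)) (z (i + 1)) with hle | hle
  · rw [max_eq_right hle] at hesc hmax
    have hx2 := (le_max_left _ _).trans (hmax (i + 2))
    have h1 := (hesc (i + 1)).eq_of_apply_le hx2 (hg (i + 1))
    have hzx : z (i + 1) = x (i + 2) := by
      have := hg (i + 1); rw [h1] at this; exact this.symm
    refine hedge (i + 1) hzx ?_ (hred (i + 1) h1)
    rw [max_eq_right hle]
    exact le_antisymm (hzx.trans_le (le_max_left _ _)) (hmax _)
  · rw [max_eq_left hle] at hesc hmax
    have hzi := (le_max_right _ _).trans (hmax i)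
    have h1 := (hesc i).eq_of_le_apply ((hg i).trans_le hzi)
    have hzx : z i = x (i + 1) := by
      have := hg i; rw [h1] at this; exact this.symm
    refine hedge i hzx ?_ (hred i h1)
    rw [max_eq_left hle]
    exact le_antisymm (hmax _) (hzx.symm.trans_le (le_max_right _ _))

/-! ### Words in `G` and `f` -/

/-- The product of the first `n` terms of a sequence in a monoid. -/
def seqProd {M : Type*} [Monoid M] (t : ℕ → M) (n : ℕ) : M := ((List.range n).map t).prod

theorem seqProd_succ {M : Type*} [Monoid M] (t : ℕ → M) (n : ℕ) :
    seqProd t (n + 1) = seqProd t n * t n := by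
  simp [seqProd, List.range_succ]

theorem seqProd_add {M : Type*} [Monoid M] (t : ℕ → M) (m n : ℕ) :
    seqProd t (m + n) = seqProd t m * seqProd (fun i => t (m + i)) n := by
  induction n with
  | zero => simp [seqProd]
  | succ n ih => rw [← Nat.add_assoc, seqProd_succ, ih, seqProd_succ, mul_assoc]

theorem mk_fixedPoints_conj {α : Type u} (c h : Equiv.Perm α) :
    #{x | (c * h * c⁻¹) x = x} = #{x | h x = x} :=
  mk_congr (c.symm.subtypeEquiv fun x => by
    simp only [mem_ofPred_eq, Equiv.Perm.mul_apply, ← Equiv.Perm.inv_def]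
    exact Equiv.Perm.eq_inv_iff_eq.symm)

/-- The hypotheses on a permutation which make it generic over a cofinitary group `G`. -/
structure IsGenericOver (G : Subgroup (Equiv.Perm (Pt κ))) (f : Equiv.Perm (Pt κ)) : Prop where
  ne : ∀ x, f x ≠ x
  inj : Function.Injective fun x => max x (f x)
  small : ∀ g ∈ G, #{m | m ∈ range (fun x => max x (f x)) ∧ ¬ Escapes g m} < κ

/-- A cyclically reduced word in which `f` occurs has fewer than `κ` fixed points. -/
theorem IsGenericOver.isCofinitaryPerm_seqProd (hκ : κ.IsRegular)
    {G : Subgroup (Equiv.Perm (Pt κ))} {f : Equiv.Perm (Pt κ)} (hf : IsGenericOver G f)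
    {k : ℕ} (hk : 0 < k) {t : ℕ → Equiv.Perm (Pt κ) × ℤˣ} (hper : ∀ i, t (i + k) = t i)
    (hG : ∀ i, (t i).1 ∈ G) (hred : ∀ i, (t i).1 = 1 → (t (i + 1)).2 = (t i).2) :
    IsCofinitaryPerm (seqProd (fun i => letterPerm f (t i)) k) := by
  let P := seqProd fun i => letterPerm f (t i)
  let T : Set (Pt κ) := ⋃ j : ULift.{u} (Fin k), {m | m ∈ range (fun x => max x (f x)) ∧ ¬ Escapes (t j.down).1 m}
  have hT : #T < κ := by
    refine (card_iUnion_lt_iff_forall_of_isRegular hκ ?_).2 fun j => hf.small _ (hG _)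
    exact (lt_aleph0_of_finite _).trans_le hκ.aleph0_le
  obtain ⟨b, hb⟩ := exists_strict_bound hκ hT
  refine (mk_le_mk_of_subset fun y hy => ?_).trans_lt (mk_Iic_lt_card hκ b)
  have hmod : ∀ i, t i = t (i % k) := fun i => by
    exact (Function.Periodic.map_mod_nat hper i).symm
  have hPk : ∀ n, P (n + k) = P k * P n := fun n => by
    rw [Nat.add_comm]
    refine (seqProd_add _ k n).trans ?_
    congr 2
    funext i
    rw [Nat.add_comm, hper]
  have hyk : (P k)⁻¹ y = y := Equiv.Perm.inv_eq_iff_eq.2 (mem_ofPred_eq ▸ hy).symm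
  -- Peeling letters off the left of the word traces a walk from `y`, which closes up because the
  -- word fixes `y`.
  let x : ℕ → Pt κ := fun n => (P n)⁻¹ y
  have hx : ∀ n, x (n + k) = x n := fun n => by
    simp only [x, hPk, mul_inv_rev, Equiv.Perm.mul_apply, hyk]
  have hxs : ∀ n, (f ^ ((t n).2 : ℤ)) ((t n).1 (x (n + 1))) = x n := fun n => by
    have : P (n + 1) = P n * letterPerm f (t n) := seqProd_succ _ n
    simp only [x, this, mul_inv_rev, letterPerm, Equiv.Perm.mul_apply]
    simp
  obtain ⟨i, j, h0, hesc⟩ := exists_not_escapes hf.ne hf.inj hk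
    (g := fun i => (t i).1) (e := fun i => (t i).2) (x := x) (z := fun i => (t i).1 (x (i + 1)))
    hred hx (fun i => by rw [hper, Nat.add_right_comm, hx]) hxs (fun i => rfl)
  have h0' : y ≤ max (x i) ((t i).1 (x (i + 1))) := h0
  refine h0'.trans (hb _ (mem_iUnion.2 ⟨⟨⟨j % k, Nat.mod_lt _ hk⟩⟩, ?_, ?_⟩)).le
  · have := hxs i
    rcases Int.units_eq_one_or (t i).2 with h | h <;> rw [h] at this
    · simp only [Units.val_one, zpow_one] at this
      exact ⟨_, by rw [← this]; exact max_comm _ _⟩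
    · simp only [Units.val_neg, Units.val_one, zpow_neg, zpow_one,
        Equiv.Perm.inv_eq_iff_eq] at this
      exact ⟨x i, by rw [this]⟩
  · simpa only [← hmod] using hesc

theorem exists_periodic_eq_map_range {α : Type*} {L : List α} (hL : L ≠ []) :
    ∃ t : ℕ → α, (∀ i, t (i + L.length) = t i) ∧ (∀ i, t i ∈ L) ∧
      (List.range L.length).map t = L := by
  have hk : 0 < L.length := List.length_pos_iff.2 hL
  refine ⟨fun i => L[i % L.length]'(Nat.mod_lt _ hk), fun i => by simp, fun i => by simp, ?_⟩
  apply List.ext_getElem (by simp)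
  intro i h1 h2
  simp [Nat.mod_eq_of_lt h2]

/-- Every element of the group generated by `G` and `f` is trivial or cofinitary. -/
theorem IsGenericOver.eq_one_or_isCofinitaryPerm (hκ : κ.IsRegular)
    {G : Subgroup (Equiv.Perm (Pt κ))} (hcof : IsCofinitaryGroup G) {f : Equiv.Perm (Pt κ)}
    (hf : IsGenericOver G f) (n : ℕ) : ∀ (L : List (Equiv.Perm (Pt κ) × ℤˣ)), L.length = n →
      (∀ p ∈ L, p.1 ∈ G) → ∀ g ∈ G, g * (L.map (letterPerm f)).prod = 1 ∨
        IsCofinitaryPerm (g * (L.map (letterPerm f)).prod) := by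
  have conj : ∀ c h : Equiv.Perm (Pt κ), (h = 1 ∨ IsCofinitaryPerm h) →
      (c * h * c⁻¹ = 1 ∨ IsCofinitaryPerm (c * h * c⁻¹)) := fun c h H => by
    refine H.imp (fun h1 => by simp [h1]) fun H => ?_
    rwa [IsCofinitaryPerm, mk_fixedPoints_conj]
  -- Conjugation and rotation preserve the alternative. A cancelling pair removes two letters and
  -- leaves a coefficient from `G` in front, which is why the statement allows `g`.
  induction n using Nat.strong_induction_on with
  | _ n ih =>
  intro L hLn hLG g hg
  rcases List.eq_nil_or_concat L with rfl | ⟨L₀, ⟨g₁, e₁⟩, rfl⟩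
  · simpa using or_iff_not_imp_left.2 (hcof g hg)
  -- conjugate the leading coefficient into the last letter
  let L₁ := L₀ ++ [(g₁ * g, e₁)]
  have hL₁n : L₁.length = n := by simpa [L₁] using hLn
  have hL₁G : ∀ p ∈ L₁, p.1 ∈ G := fun p hp => by
    rcases List.mem_append.1 hp with hp | hp
    · exact hLG p (by simp [hp])
    · rw [List.mem_singleton.1 hp]
      exact G.mul_mem (hLG (g₁, e₁) (by simp)) hg
  suffices H : (L₁.map (letterPerm f)).prod = 1 ∨
      IsCofinitaryPerm (L₁.map (letterPerm f)).prod by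
    convert conj g _ H using 2 <;> simp [L₁, letterPerm, mul_assoc]
  obtain ⟨t, hper, htL, htmap⟩ := exists_periodic_eq_map_range (L := L₁) (by simp [L₁])
  rw [hL₁n] at hper htmap
  have hprod : (L₁.map (letterPerm f)).prod = seqProd (fun i => letterPerm f (t i)) n := by
    rw [← htmap, List.map_map]; rfl
  have hn : 0 < n := by rw [← hL₁n]; simp [L₁]
  rw [hprod]
  by_cases hred : ∀ i, (t i).1 = 1 → (t (i + 1)).2 = (t i).2
  · exact Or.inr (hf.isCofinitaryPerm_seqProd hκ hn hper (fun i => hL₁G _ (htL i)) hred)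
  push Not at hred
  obtain ⟨i, hi1, hi⟩ := hred
  let s : ℕ → Equiv.Perm (Pt κ) := fun j => letterPerm f (t j)
  -- rotate the word so that the cancelling letters stand in front
  suffices H : seqProd (fun j => s (i + j)) n = 1 ∨ IsCofinitaryPerm (seqProd (fun j => s (i + j)) n) by
    have h1 : seqProd s n * seqProd s i = seqProd s i * seqProd (fun j => s (i + j)) n := by
      rw [← seqProd_add, Nat.add_comm, seqProd_add]
      congr 2
      funext j
      simp only [s, Nat.add_comm n j, hper]
    have h2 := conj (seqProd s i) _ H
    rwa [← h1, mul_inv_cancel_right] at h2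
  -- A single letter is its own cyclic neighbour and cannot cancel.
  obtain ⟨m, rfl⟩ : ∃ m, n = m + 2 := by
    rcases Nat.lt_or_ge n 2 with h | h
    · obtain rfl : n = 1 := by omega
      exact (hi (by rw [hper])).elim
    · exact ⟨n - 2, by omega⟩
  have hcancel : s i * s (i + 1) = (t (i + 1)).1 := by
    have : (t (i + 1)).2 = -(t i).2 := by
      rcases Int.units_eq_one_or (t i).2 with h | h <;>
        rcases Int.units_eq_one_or (t (i + 1)).2 with h' | h' <;> simp_all
    simp [s, letterPerm, hi1, this]
  have hsplit : seqProd (fun j => s (i + j)) (m + 2) =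
      (t (i + 1)).1 * (((List.range m).map fun j => t (i + (2 + j))).map (letterPerm f)).prod := by
    rw [Nat.add_comm m 2, seqProd_add]
    refine congrArg₂ _ ?_ ?_
    · simpa [seqProd, List.range_succ] using hcancel
    · rw [List.map_map]; rfl
  rw [hsplit]
  refine ih m (by omega) _ (by simp) (fun p hp => ?_) _ (hL₁G _ (htL _))
  obtain ⟨j, -, rfl⟩ := List.mem_map.1 hp
  exact hL₁G _ (htL _)

/-- Multiplying by `f` or `f⁻¹` turns the leading coefficient into a new letter; multiplying by an
element of `G` only changes that coefficient. -/
theorem exists_word_of_mem_closure {α : Type*} {G : Subgroup (Equiv.Perm α)} {f h : Equiv.Perm α}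
    (hh : h ∈ Subgroup.closure (insert f (G : Set (Equiv.Perm α)))) :
    ∃ (L : List (Equiv.Perm α × ℤˣ)) (g : Equiv.Perm α), (∀ p ∈ L, p.1 ∈ G) ∧ g ∈ G ∧
      h = g * (L.map (letterPerm f)).prod := by
  induction hh using Subgroup.closure_induction_left with
  | one => exact ⟨[], 1, by simp, G.one_mem, by simp⟩
  | mul_left x hx y hy ih =>
    obtain ⟨L, g, hL, hg, rfl⟩ := ih
    rcases hx with rfl | hx
    · exact ⟨(g, 1) :: L, 1, by simpa [hg] using hL, G.one_mem, by simp [letterPerm, mul_assoc]⟩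
    · exact ⟨L, x * g, hL, G.mul_mem hx hg, (mul_assoc _ _ _).symm⟩
  | inv_mul_cancel x hx y hy ih =>
    obtain ⟨L, g, hL, hg, rfl⟩ := ih
    rcases hx with rfl | hx
    · exact ⟨(g, -1) :: L, 1, by simpa [hg] using hL, G.one_mem, by simp [letterPerm, mul_assoc]⟩
    · exact ⟨L, x⁻¹ * g, hL, G.mul_mem (G.inv_mem hx) hg, (mul_assoc _ _ _).symm⟩

/-! ### Maximality and the inequality -/

/-- A generic permutation does not belong to the group. -/
theorem IsGenericOver.notMem (hκ : κ.IsRegular) {G : Subgroup (Equiv.Perm (Pt κ))}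
    {f : Equiv.Perm (Pt κ)} (hf : IsGenericOver G f) : f ∉ G := fun hfG => by
  -- The one-letter word `f * f⁻¹` fixes all `κ` points.
  have h := hf.isCofinitaryPerm_seqProd hκ one_pos (t := fun _ => (f⁻¹, 1)) (fun _ => rfl)
    (fun _ => G.inv_mem hfG) (fun _ _ => rfl)
  simp [seqProd, letterPerm, IsCofinitaryPerm] at h

/-- A maximal cofinitary group has no generic permutation. -/
theorem IsMaximalCofinitaryGroup.not_isGenericOver (hκ : κ.IsRegular)
    {G : Subgroup (Equiv.Perm (Pt κ))} (hG : IsMaximalCofinitaryGroup G)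
    (f : Equiv.Perm (Pt κ)) : ¬ IsGenericOver G f := fun hf => by
  let H := Subgroup.closure (insert f (G : Set (Equiv.Perm (Pt κ))))
  have hGH : G ≤ H := fun g hg => Subgroup.subset_closure (mem_insert_of_mem _ hg)
  have hH : IsCofinitaryGroup H := fun h hh hne => by
    obtain ⟨L, g, hL, hg, rfl⟩ := exists_word_of_mem_closure hh
    exact (hf.eq_one_or_isCofinitaryPerm hκ hG.1 _ L rfl hL g hg).resolve_left hne
  exact hf.notMem hκ (hG.2 H hH hGH ▸ Subgroup.subset_closure (mem_insert _ _))

/-- A pseudointersection of the closed unbounded sets of closure points of members of a cofinitary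
group yields a generic permutation. -/
theorem exists_isGenericOver (hκ : κ.IsRegular) (hω : ℵ₀ < κ)
    {G : Subgroup (Equiv.Perm (Pt κ))} (hG : IsCofinitaryGroup G) {A : Set (Pt κ)} (hA : #A = κ)
    (hsub : ∀ g ∈ G, AlmostSubset A {m | ∀ v < m, g v < m}) : ∃ f, IsGenericOver G f := by
  obtain ⟨f, hne, hmem, hinj⟩ := exists_perm_max_mem hκ hω hA
  refine ⟨f, hne, hinj, fun g hg => ?_⟩
  have hfix : #{x | g ≠ 1 ∧ g x = x} < κ := by
    by_cases h1 : g = 1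
    · simpa [h1] using aleph0_pos.trans hω
    · simpa [h1] using (id (hG g hg h1) : #{x | g x = x} < κ)
  refine (mk_le_mk_of_subset ?_).trans_lt <| (mk_union_le _ _).trans_lt <|
    add_lt_of_lt hκ.aleph0_le (hsub g hg) <| (mk_union_le _ _).trans_lt <|
    add_lt_of_lt hκ.aleph0_le (hsub g⁻¹ (G.inv_mem hg)) hfix
  rintro _ ⟨⟨x, rfl⟩, hx⟩
  by_contra hcon
  simp only [mem_union, mem_sdiff, mem_ofPred_eq, hmem, true_and, not_or, not_not, not_and] at hcon
  exact hx ⟨hcon.1, hcon.2.1, fun h => by_contra fun h1 => hcon.2.2 h1 h⟩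

theorem pNumber_le_mk_of_isMaximalCofinitaryGroup (hκ : κ.IsRegular) (hω : ℵ₀ < κ)
    {G : Subgroup (Equiv.Perm (Pt κ))} (hG : IsMaximalCofinitaryGroup G) : pNumber κ ≤ #G := by
  let F : Set (Set (Pt κ)) := range fun g : G => {m | ∀ v < m, g.1 v < m}
  have hF : IsWitness F := by
    refine ⟨hasSIP_of_isClub hκ hω ?_, ?_⟩
    · rintro _ ⟨g, rfl⟩
      exact isClub_closurePoints hκ hω g.1
    · rintro ⟨A, hA, hAF⟩
      obtain ⟨f, hf⟩ := exists_isGenericOver hκ hω hG.1 hA fun g hg => hAF _ ⟨⟨g, hg⟩, rfl⟩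
      exact hG.not_isGenericOver hκ f hf
  have h : pNumber κ ≤ #F := csInf_le' ⟨F, hF, rfl⟩
  exact h.trans mk_range_le

end HigherBaire

theorem theorem3p5 (κ : Cardinal.{u}) (hreg : κ.IsRegular) (hunc : Cardinal.aleph0 < κ)
    (hpow : Cardinal.powerlt κ κ = κ) :
    HigherBaire.pNumber κ ≤ HigherBaire.agNumber κ := by
  -- The infimum of the empty set would be `0`.
  obtain ⟨G, hG⟩ := HigherBaire.exists_isMaximalCofinitaryGroup κ
  refine le_csInf ⟨_, G, hG, rfl⟩ ?_
  rintro _ ⟨G, hG, rfl⟩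
  exact HigherBaire.pNumber_le_mk_of_isMaximalCofinitaryGroup hreg hunc hG
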